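/- Let $I=[0,1]$ and let $I^{\omega_1}$ carry the product topology. A space is *Lindelöf* if every open covering of it has a countable subcovering. A Lindelöf space $X$ is *productively Lindelöf* if $X\times Y$ is Lindelöf for every Lindelöf space $Y$. A space $X$ is *Menger* if for every sequence $(\mathcal U_n)_{n\in\omega}$ of open coverings of $X$ there are finite $\mathcal V_n\subseteq\mathcal U_n$ with $\bigcup_{n}\bigcup\mathcal V_n=X$. A family $\mathcal G$ of $G_\delta$ sets is an *Alster covering* of $X$ if every compact $K\subseteq X$ is contained in some $G\in\mathcal G$. A space is an *Alster space* if every Alster covering of it by $G_\delta$ subsets of the space has a countable subcovering. **Theorem.** (1) Let $X\subseteq I^{\omega_1}$ be a productively Lindelöf Menger space and let $\mathcal G$ be an Alster covering of $X$ with $|\mathcal G|=\omega_1$ consisting of Lindelöf $G_\delta$ subsets of $I^{\omega_1}$. Then there is a countably infinite subfamily $\mathcal G'\subseteq\mathcal G$ such that $X\subseteq\bigcup\mathcal G'$. (2) Assume the continuum hypothesis. Then a Tychonoff space of weight at most $\aleph_1$ is productively Lindelöf if and only if it is an Alster space. -/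

import Mathlib

open Set
open scoped Cardinal

/-- The index set `ω₁`: the well-ordered set of all countable ordinals (of cardinality `ℵ₁`). -/
abbrev OmegaOne : Type := (Ordinal.omega.{0} 1).ToType

/-- The Tychonoff cube `I^{ω₁}`, `I = [0,1]`, with the product topology. -/
abbrev TychonoffCube : Type := OmegaOne → unitInterval

universe u v

/-- A Lindelöf space `X` is productively Lindelöf if `X × Y` is Lindelöf for every Lindelöf
space `Y`. No separation axiom is imposed on `Y`. -/
def ProductivelyLindelof (X : Type u) [TopologicalSpace X] : Prop :=
  LindelofSpace X ∧
    ∀ (Y : Type v) [TopologicalSpace Y], LindelofSpace Y → LindelofSpace (X × Y)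

/-- `𝒰` is an open covering of the space `X`. -/
def IsOpenCovering (X : Type u) [TopologicalSpace X] (𝒰 : Set (Set X)) : Prop :=
  (∀ U ∈ 𝒰, IsOpen U) ∧ ⋃₀ 𝒰 = univ

/-- The Menger property: from every sequence of open coverings one can select finitely many
members of each so that all the selected sets together cover the space. -/
def MengerSpace (X : Type u) [TopologicalSpace X] : Prop :=
  ∀ 𝒰 : ℕ → Set (Set X), (∀ n, IsOpenCovering X (𝒰 n)) →
    ∃ 𝒱 : ℕ → Set (Set X), (∀ n, 𝒱 n ⊆ 𝒰 n ∧ (𝒱 n).Finite) ∧ ⋃ n, ⋃₀ 𝒱 n = univ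

/-- An Alster covering of the subset `X` of the space `E` by `G_δ` subsets of `E`: every compact
subset of `X` is contained in a single member. (With `X = univ` this is an Alster covering
of the space `E` itself.) -/
def IsAlsterCovering {E : Type u} [TopologicalSpace E] (X : Set E) (𝒢 : Set (Set E)) : Prop :=
  (∀ G ∈ 𝒢, IsGδ G) ∧ ∀ K : Set E, K ⊆ X → IsCompact K → ∃ G ∈ 𝒢, K ⊆ G

/-- An Alster space: every Alster covering has a countable subcovering. -/
def AlsterSpace (X : Type u) [TopologicalSpace X] : Prop :=
  ∀ 𝒢 : Set (Set X), IsAlsterCovering univ 𝒢 →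
    ∃ 𝒢' ⊆ 𝒢, 𝒢'.Countable ∧ ⋃₀ 𝒢' = univ

/-- The weight of a space: the least cardinality of a base of its topology. -/
noncomputable def topologicalWeight (X : Type u) [TopologicalSpace X] : Cardinal.{u} :=
  sInf {κ : Cardinal.{u} | ∃ B : Set (Set X), TopologicalSpace.IsTopologicalBasis B ∧ #B = κ}

/-- The continuum hypothesis. -/
def ContinuumHypothesis : Prop := Cardinal.aleph.{0} 1 = Cardinal.continuum.{0}

/-!
Let `X` be a subspace of a compact space `E` that has a closed neighbourhood base `B i` indexed by
`i < ω₁`, and let the `G_δ` sets `G ξ`, `ξ < ω₁`, form an Alster covering of `X`. Suppose that no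
countable subfamily covers `X`, and choose `x α ∈ X` outside of all `G ξ` with `ξ < α`. A Lindelöf
space `Y` with `X × Y` not Lindelöf is obtained as follows. Its points are the `x α`, isolated, and
all pairs `(α, t)` such that `t` is outside of all `G ξ`, `ξ < α`, and the sets `B i`, `i < α`, with
`t` in the interior already separate `t` from every point of `X`; a basic neighbourhood of `(α, t)`
is given by finitely many of these `B i` and consists of the pairs `(γ, s)` with all their indices
below `γ` and `s` in all their interiors, and of the `x α` lying in all of them. The complements of
the `B i` cover `X`, so that each point of `Y` is an open covering of `X`
(`ProductivelyLindelof.exists_countable_index`), while no countable set of indices serves all `x α`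
(`ProductivelyLindelof.false_of_concentrated`).

The Lindelöf property of `Y` is the point. Given a neighbourhood for each `(α, t)`, let `C β` be the
closed set of points of `E` not caught by those chosen neighbourhoods whose indices are all below
`β`; the possible index sets are the countably many finite sets below `β`. A point of `C β` outside
of all `G ξ`, `ξ < β`, cannot be separated from `X` by indices below `β`. If some `C β` is covered
by the `G ξ` with `ξ < β`, then countably many of the chosen neighbourhoods cover all of `Y` but the
`x α` with `α ≤ β`. Otherwise, call a closed set big if it meets all differences
`C β \ ⋃ ξ < β, G ξ`. Every big closed set has a point outside of `X` at which it is locally big, for otherwise these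
points would form a compact subset of `X`, contained in a single `G ξ`
(`IsBig.exists_notMem_range`). Shrinking neighbourhoods of such points, while avoiding more and more
of the `G ξ`, defines a strategy in the Menger game, and each play leads to a point of `X` that is
never covered; by Hurewicz's theorem (`MengerSpace.exists_play`), this contradicts the Menger
property (`MengerSpace.exists_subset_iUnion_lt`).

Under the continuum hypothesis, productively Lindelöf spaces are Menger, by a similar construction
from points `x α` that diagonalize against all selections from a sequence of coverings
(`ProductivelyLindelof.mengerSpace`). Moreover, a completely regular space of weight at most `ℵ₁`
embeds in the cube, and every Alster covering is refined by one of size `ℵ₁`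
(`IsAlsterCovering.exists_refinement`). That Alster spaces are productively Lindelöf is an
application of the tube lemma (`AlsterSpace.productivelyLindelof`).
-/

open Topology

/-! ### The well-ordered set of countable ordinals -/

lemma mk_omegaOne : #OmegaOne = Cardinal.aleph 1 := by
  simp [OmegaOne, Cardinal.mk_toType, Ordinal.card_omega]

lemma OmegaOne.countable_Iio (a : OmegaOne) : (Iio a).Countable := by
  have h : #(Iio a) < #OmegaOne := Cardinal.mk_Iio_lt a (by
    rw [mk_omegaOne, Cardinal.ord_aleph, Ordinal.type_toType])
  rw [mk_omegaOne, ← Cardinal.succ_aleph0, Order.lt_succ_iff] at h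
  exact Cardinal.le_aleph0_iff_set_countable.1 h

lemma OmegaOne.countable_Iic (a : OmegaOne) : (Iic a).Countable := by
  rw [← Iio_insert]
  exact (OmegaOne.countable_Iio a).insert a

lemma OmegaOne.not_countable_univ : ¬ (univ : Set OmegaOne).Countable := by
  rw [← Cardinal.le_aleph0_iff_set_countable, Cardinal.mk_univ, mk_omegaOne, not_le]
  exact Cardinal.aleph0_lt_aleph_one

lemma OmegaOne.exists_forall_lt {s : Set OmegaOne} (hs : s.Countable) : ∃ b, ∀ a ∈ s, a < b := by
  by_contra! h
  refine OmegaOne.not_countable_univ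
    ((hs.biUnion fun a _ => OmegaOne.countable_Iic a).mono fun b _ => ?_)
  obtain ⟨a, ha, hab⟩ := h b
  exact mem_biUnion ha hab

/-- Every sequence in `ω₁` has a supremum. -/
lemma OmegaOne.exists_sup (a : ℕ → OmegaOne) :
    ∃ b, (∀ n, a n ≤ b) ∧ ∀ c < b, ∃ n, c < a n := by
  obtain ⟨b₀, hb₀⟩ := OmegaOne.exists_forall_lt (countable_range a)
  have hne : {b | ∀ n, a n ≤ b}.Nonempty := ⟨b₀, fun n => (hb₀ _ ⟨n, rfl⟩).le⟩
  refine ⟨wellFounded_lt.min _ hne, wellFounded_lt.min_mem _ hne, fun c hc => ?_⟩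
  by_contra! h
  exact wellFounded_lt.not_lt_min {b | ∀ n, a n ≤ b} h hc

instance : Nonempty OmegaOne := by
  rw [← Cardinal.mk_ne_zero_iff, mk_omegaOne]
  exact (Cardinal.aleph_pos 1).ne'

/-- A nonempty type of cardinality at most `ℵ₁` is the range of a family indexed by `ω₁`. -/
lemma exists_range_eq_of_mk_le {P : Type u} [Nonempty P]
    (h : #P ≤ Cardinal.aleph 1) : ∃ f : OmegaOne → P, Function.Surjective f := by
  have : Cardinal.lift.{0} #P ≤ Cardinal.lift.{u} #OmegaOne := by
    rw [mk_omegaOne]; simpa using h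
  obtain ⟨g⟩ := Cardinal.lift_mk_le'.1 this
  exact ⟨Function.invFun g, Function.invFun_surjective g.injective⟩

/-! ### Products with spaces of open coverings -/

lemma exists_finset_image_eq {α β : Type*} {f : α → β} {s : Set β} (hs : s.Finite)
    (h : s ⊆ range f) : ∃ t : Finset α, f '' t = s := by
  obtain ⟨t, rfl⟩ := subset_range_iff_exists_image_eq.1 h
  obtain ⟨u, -, hu⟩ := exists_subset_bijOn t f
  have hfin : u.Finite := (hu.image_eq ▸ hs : (f '' u).Finite).of_finite_image hu.injOn
  exact ⟨hfin.toFinset, by rw [hfin.coe_toFinset, hu.image_eq]⟩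

/-- Each `k : K` names an open covering `{U i | i ∈ y k}` of `X`. Topologize `K` by declaring the
sets `{k | i ∈ y k}` open; if this makes `K` Lindelöf, then a countable set of indices suffices for
all these coverings simultaneously, because the rectangles `U i × {k | i ∈ y k}` cover `X × K`. -/
lemma ProductivelyLindelof.exists_countable_index {X : Type u} [TopologicalSpace X]
    (hX : ProductivelyLindelof.{u, v} X) {K : Type v} {ι : Type*} (U : ι → Set X)
    (hU : ∀ i, IsOpen (U i)) (y : K → Set ι) (hy : ∀ k x, ∃ i ∈ y k, x ∈ U i)
    (H : ∀ S : K → Finset ι, (∀ k, ↑(S k) ⊆ y k) →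
      ∃ K₀ : Set K, K₀.Countable ∧ ∀ k', ∃ k ∈ K₀, ↑(S k) ⊆ y k') :
    ∃ I : Set ι, I.Countable ∧ ∀ k x, ∃ i ∈ y k ∩ I, x ∈ U i := by
  let V : ι → Set K := fun i => {k | i ∈ y k}
  let _ : TopologicalSpace K := TopologicalSpace.generateFrom (range V)
  have hV : ∀ i, IsOpen (V i) := fun i => TopologicalSpace.isOpen_generateFrom_of_mem ⟨i, rfl⟩
  have hK : LindelofSpace K := by
    refine ⟨isLindelof_of_countable_subcover fun {κ} W hW hcov => ?_⟩
    have key : ∀ k, ∃ w : κ, ∃ S : Finset ι, ↑S ⊆ y k ∧ ∀ k', ↑S ⊆ y k' → k' ∈ W w := by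
      intro k
      obtain ⟨w, hw⟩ := mem_iUnion.1 (hcov (mem_univ k))
      obtain ⟨_, ⟨f, ⟨hf, hfV⟩, rfl⟩, hkf, hfW⟩ :=
        (TopologicalSpace.isTopologicalBasis_of_subbasis rfl).isOpen_iff.1 (hW w) k hw
      obtain ⟨S, rfl⟩ := exists_finset_image_eq hf hfV
      refine ⟨w, S, fun i hi => hkf _ (mem_image_of_mem V hi), fun k' hk' => hfW ?_⟩
      rintro _ ⟨i, hi, rfl⟩
      exact hk' hi
    choose w S hS hSW using key
    obtain ⟨K₀, hK₀, hcov₀⟩ := H S hS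
    refine ⟨w '' K₀, hK₀.image w, fun k' _ => ?_⟩
    obtain ⟨k, hk, hkk'⟩ := hcov₀ k'
    exact mem_biUnion (mem_image_of_mem w hk) (hSW k k' hkk')
  have := hX.2 K hK
  obtain ⟨I, hI, hcov⟩ := isLindelof_univ.elim_countable_subcover (X := X × K)
    (fun i => U i ×ˢ V i) (fun i => (hU i).prod (hV i)) (fun p _ => by
      obtain ⟨i, hi, hx⟩ := hy p.2 p.1
      exact mem_iUnion.2 ⟨i, hx, hi⟩)
  refine ⟨I, hI, fun k x => ?_⟩
  obtain ⟨i, hi, hx, hk⟩ := mem_iUnion₂.1 (hcov (mem_univ (x, k)))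
  exact ⟨i, ⟨hk, hi⟩, hx⟩

/-- A Michael-type construction. The coverings `q j` are supplemented by uncountably many isolated
points, the `α`-th of which names all `U i` avoiding the point `x α` together with a private copy
of the whole space. If all but countably many of these isolated points are absorbed by every
neighbourhood assignment on the coverings `q j`, the resulting space is Lindelöf, although no
countable set of indices contains all the private copies. -/
lemma ProductivelyLindelof.false_of_concentrated {X : Type u} [TopologicalSpace X]
    (hX : ProductivelyLindelof.{u, v} X) {ι J : Type} (U : ι → Set X)
    (hU : ∀ i, IsOpen (U i)) (q : J → Set ι) (hq : ∀ j x, ∃ i ∈ q j, x ∈ U i)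
    (x : OmegaOne → X)
    (H : ∀ S : J → Finset ι, (∀ j, ↑(S j) ⊆ q j) →
      ∃ J₀ : Set J, J₀.Countable ∧ (∀ j', ∃ j ∈ J₀, ↑(S j) ⊆ q j') ∧
        ∃ β, ∀ α > β, ∃ j ∈ J₀, ∀ i ∈ S j, x α ∉ U i) : False := by
  classical
  let y : J ⊕ OmegaOne → Set (ι ⊕ OmegaOne) :=
    Sum.elim (fun j => Sum.inl '' q j) fun α => insert (Sum.inr α) (Sum.inl '' {i | x α ∉ U i})
  obtain ⟨I, hI, hcov⟩ := hX.exists_countable_index (K := ULift.{v} (J ⊕ OmegaOne))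
    (ι := ι ⊕ OmegaOne) (Sum.elim U fun _ => univ) (by rintro (i | α) <;> simp [hU])
    (fun k => y k.down) (by
      rintro ⟨j | α⟩ z
      · obtain ⟨i, hi, hz⟩ := hq j z
        exact ⟨Sum.inl i, mem_image_of_mem _ hi, hz⟩
      · exact ⟨Sum.inr α, mem_insert _ _, mem_univ _⟩) (by
      intro S hS
      let S' : J → Finset ι := fun j => (S ⟨Sum.inl j⟩).preimage Sum.inl Sum.inl_injective.injOn
      have hS' : ∀ j, (S ⟨Sum.inl j⟩ : Set (ι ⊕ OmegaOne)) = Sum.inl '' (S' j : Set ι) := by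
        intro j
        ext i
        constructor
        · intro hi
          obtain ⟨i', -, rfl⟩ := hS ⟨Sum.inl j⟩ hi
          exact ⟨i', by simpa [S'] using hi, rfl⟩
        · rintro ⟨i', hi', rfl⟩
          simpa [S'] using hi'
      obtain ⟨J₀, hJ₀, hJ, β, hβ⟩ := H S' fun j i hi => by
        have : Sum.inl i ∈ Sum.inl '' q j :=
          hS ⟨Sum.inl j⟩ (by rw [hS']; exact mem_image_of_mem _ hi)
        simpa using this
      refine ⟨(fun j => ⟨Sum.inl j⟩) '' J₀ ∪ (fun α => ⟨Sum.inr α⟩) '' Iic β,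
        (hJ₀.image _).union ((OmegaOne.countable_Iic β).image _), ?_⟩
      rintro ⟨j' | α⟩
      · obtain ⟨j, hj, h⟩ := hJ j'
        refine ⟨_, Or.inl (mem_image_of_mem _ hj), ?_⟩
        rw [hS']
        exact image_mono h
      · rcases le_or_gt α β with h | h
        · exact ⟨_, Or.inr (mem_image_of_mem _ h), hS _⟩
        · obtain ⟨j, hj, h⟩ := hβ α h
          refine ⟨_, Or.inl (mem_image_of_mem _ hj), ?_⟩
          rw [hS']
          rintro _ ⟨i, hi, rfl⟩
          exact Or.inr (mem_image_of_mem _ (h i hi)))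
  obtain ⟨α, hα⟩ : ∃ α, Sum.inr α ∉ I := by
    by_contra! h
    refine OmegaOne.not_countable_univ ((hI.preimage Sum.inr_injective).mono fun α _ => h α)
  obtain ⟨i, ⟨rfl | ⟨i, hi, rfl⟩, hiI⟩, hx⟩ := hcov ⟨Sum.inr α⟩ (x α)
  · exact hα hiI
  · exact hi hx

/-! ### The Menger property -/

/-- The Menger property, specialized to increasing countable coverings. -/
lemma MengerSpace.exists_selection {X : Type u} [TopologicalSpace X] (hX : MengerSpace X)
    (W : ℕ → ℕ → Set X) (hW : ∀ n k, IsOpen (W n k)) (hmono : ∀ n, Monotone (W n))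
    (hcov : ∀ n x, ∃ k, x ∈ W n k) : ∃ h : ℕ → ℕ, ∀ x, ∃ n, x ∈ W n (h n) := by
  obtain ⟨𝒱, h𝒱, hun⟩ := hX (fun n => range (W n)) fun n =>
    ⟨by rintro _ ⟨k, rfl⟩; exact hW n k, by
      rw [eq_univ_iff_forall]
      intro x
      obtain ⟨k, hk⟩ := hcov n x
      exact ⟨_, ⟨k, rfl⟩, hk⟩⟩
  have : ∀ n, ∃ h, ∀ V ∈ 𝒱 n, V ⊆ W n h := by
    intro n
    obtain ⟨s, hs⟩ := exists_finset_image_eq (h𝒱 n).2 (h𝒱 n).1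
    refine ⟨s.sup id, fun V hV => ?_⟩
    rw [← hs] at hV
    obtain ⟨k, hk, rfl⟩ := hV
    exact hmono n (Finset.le_sup (f := id) hk)
  choose h hh using this
  refine ⟨h, fun x => ?_⟩
  obtain ⟨n, hn⟩ := mem_iUnion.1 (hun.symm ▸ mem_univ x : x ∈ ⋃ n, ⋃₀ 𝒱 n)
  obtain ⟨V, hV, hxV⟩ := hn
  exact ⟨n, hh n V hV hxV⟩

/-- In a Lindelöf space, the Menger property follows from its version for increasing countable
coverings. -/
lemma mengerSpace_of_exists_selection {X : Type u} [TopologicalSpace X] [LindelofSpace X]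
    (H : ∀ W : ℕ → ℕ → Set X, (∀ n k, IsOpen (W n k)) → (∀ n, Monotone (W n)) →
      (∀ n x, ∃ k, x ∈ W n k) → ∃ h : ℕ → ℕ, ∀ x, ∃ n, x ∈ W n (h n)) : MengerSpace X := by
  intro 𝒰 h𝒰
  rcases isEmpty_or_nonempty X with hE | ⟨⟨x₀⟩⟩
  · exact ⟨fun _ => ∅, by simp, Subsingleton.elim _ _⟩
  have : ∀ n, ∃ u : ℕ → Set X, (∀ k, u k ∈ 𝒰 n) ∧ ∀ x, ∃ k, x ∈ u k := by
    intro n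
    obtain ⟨r, hr, hcov⟩ := isLindelof_univ.elim_countable_subcover
      (fun V : 𝒰 n => (V : Set X)) (fun V => (h𝒰 n).1 V V.2) (by
        rw [← sUnion_eq_iUnion, (h𝒰 n).2])
    have hne : r.Nonempty := by
      obtain ⟨V, hV, -⟩ := mem_iUnion₂.1 (hcov (mem_univ x₀))
      exact ⟨V, hV⟩
    obtain ⟨u, rfl⟩ := hr.exists_eq_range hne
    refine ⟨fun k => u k, fun k => (u k).2, fun x => ?_⟩
    obtain ⟨_, ⟨k, rfl⟩, hk⟩ := mem_iUnion₂.1 (hcov (mem_univ x))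
    exact ⟨k, hk⟩
  choose u hu hcov using this
  obtain ⟨h, hh⟩ := H (fun n k => ⋃ j ∈ Iic k, u n j)
    (fun n k => isOpen_biUnion fun j _ => (h𝒰 n).1 _ (hu n j))
    (fun n k l hkl => biUnion_mono (Iic_subset_Iic.2 hkl) fun _ _ => subset_rfl)
    (fun n x => (hcov n x).imp fun k hk => mem_biUnion (self_mem_Iic) hk)
  refine ⟨fun n => u n '' Iic (h n), fun n => ⟨?_, (finite_Iic _).image _⟩, ?_⟩
  · rintro _ ⟨k, -, rfl⟩
    exact hu n k
  · rw [eq_univ_iff_forall]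
    intro x
    obtain ⟨n, hn⟩ := hh x
    obtain ⟨j, hj, hx⟩ := mem_iUnion₂.1 hn
    exact mem_iUnion.2 ⟨n, _, mem_image_of_mem _ hj, hx⟩

/-- The initial segment of length `n` of a sequence, as a list with the latest entry first. -/
def initialSegment (f : ℕ → ℕ) : ℕ → List ℕ
  | 0 => []
  | n + 1 => f n :: initialSegment f n

/-- The point `x` is still uncovered after the given list of moves, latest first, of a Menger game.
The move `k` in the position `s` selects the `k`-th member of the increasing covering `U s`. -/
def Survives {X : Type u} (U : List ℕ → ℕ → Set X) (x : X) : List ℕ → Prop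
  | [] => True
  | k :: s => x ∉ U s k ∧ Survives U x s

/-- Hurewicz's theorem that in a Menger space no strategy of the covering player wins the Menger
game. At each length `n`, only finitely many positions are survived by a point, and even by
the points near it, so the sets of points that are covered in the next round by the answer `k` from
every surviving position of length `n` form, for varying `k`, a covering; a selection from these
coverings is the desired play. -/
lemma MengerSpace.exists_play {X : Type u} [TopologicalSpace X] (hX : MengerSpace X)
    (U : List ℕ → ℕ → Set X) (hU : ∀ s k, IsOpen (U s k)) (hmono : ∀ s, Monotone (U s))
    (hcov : ∀ s x, ∃ k, x ∈ U s k) :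
    ∃ f : ℕ → ℕ, ∀ x, ∃ n, x ∈ U (initialSegment f n) (f n) := by
  classical
  have hfin : ∀ x n, ∃ L : Finset (List ℕ), ∀ᶠ z in nhds x, ∀ s : List ℕ, s.length = n →
      Survives U z s → s ∈ L := by
    intro x n
    induction n with
    | zero =>
      refine ⟨{[]}, Filter.Eventually.of_forall fun z s hs _ => ?_⟩
      simpa using hs
    | succ n ih =>
      obtain ⟨L, hL⟩ := ih
      choose k hk using fun s => hcov s x
      refine ⟨L.biUnion fun s => (Finset.range (k s)).image fun j => j :: s, ?_⟩
      have h2 : ∀ᶠ z in nhds x, ∀ s ∈ L, z ∈ U s (k s) :=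
        (Filter.eventually_all_finset L).2 fun s _ => (hU s (k s)).mem_nhds (hk s)
      filter_upwards [hL, h2] with z hz hz2
      rintro (_ | ⟨j, s⟩) hs hsurv
      · simp at hs
      · have hsL := hz s (by simpa using hs) hsurv.2
        simp only [Finset.mem_biUnion, Finset.mem_image, Finset.mem_range]
        refine ⟨s, hsL, j, ?_, rfl⟩
        by_contra! hj
        exact hsurv.1 (hmono s hj (hz2 s hsL))
  let W : ℕ → ℕ → Set X := fun n k => {z | ∀ s : List ℕ, s.length = n → Survives U z s → z ∈ U s k}
  obtain ⟨f, hf⟩ := hX.exists_selection (fun n k => interior (W n k)) (fun _ _ => isOpen_interior)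
    (fun n k l hkl => interior_mono fun z hz s hs hsurv => hmono s hkl (hz s hs hsurv))
    (by
      intro n x
      obtain ⟨L, hL⟩ := hfin x n
      choose k hk using fun s => hcov s x
      refine ⟨L.sup k, mem_interior_iff_mem_nhds.2 ?_⟩
      have h2 : ∀ᶠ z in nhds x, ∀ s ∈ L, z ∈ U s (k s) :=
        (Filter.eventually_all_finset L).2 fun s _ => (hU s (k s)).mem_nhds (hk s)
      filter_upwards [hL, h2] with z hz hz2
      exact fun s hs hsurv => hmono s (Finset.le_sup (hz s hs hsurv)) (hz2 s (hz s hs hsurv)))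
  refine ⟨f, fun x => ?_⟩
  by_contra! hx
  have hlen : ∀ n, (initialSegment f n).length = n := by
    intro n
    induction n with
    | zero => rfl
    | succ n ih => simp [initialSegment, ih]
  have hsurv : ∀ n, Survives U x (initialSegment f n) := by
    intro n
    induction n with
    | zero => trivial
    | succ n ih => exact ⟨hx n, ih⟩
  obtain ⟨n, hn⟩ := hf x
  exact hx n (interior_subset hn _ (hlen n) (hsurv n))

/-- Under the continuum hypothesis, productively Lindelöf spaces are Menger: otherwise there are
increasing coverings and points `x α` such that every selection covers only countably many of the
`x α`, and the coverings together with these points violate productive Lindelöfness. -/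
lemma ProductivelyLindelof.mengerSpace {X : Type u} [TopologicalSpace X]
    (hX : ProductivelyLindelof.{u, v} X) (hCH : ContinuumHypothesis) : MengerSpace X := by
  have := hX.1
  refine mengerSpace_of_exists_selection fun W hW hmono hcov => ?_
  by_contra! hbad
  obtain ⟨h, hh⟩ := exists_range_eq_of_mk_le (P := ℕ → ℕ) (by
    rw [ContinuumHypothesis] at hCH
    simp [hCH])
  have hdiag : ∀ α : OmegaOne, ∃ g : ℕ → ℕ, ∀ β < α, ∃ n, h β n ≤ g n := by
    intro α
    rcases (Iio α).eq_empty_or_nonempty with hα | hα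
    · exact ⟨0, fun β hβ => absurd (show β ∈ Iio α from hβ) (by simp [hα])⟩
    · obtain ⟨b, hb⟩ := (OmegaOne.countable_Iio α).exists_eq_range hα
      refine ⟨fun n => h (b n) n, fun β hβ => ?_⟩
      obtain ⟨n, rfl⟩ := hb ▸ (show β ∈ Iio α from hβ)
      exact ⟨n, le_rfl⟩
  choose g hg using hdiag
  choose x hx using hbad
  refine hX.false_of_concentrated (ι := ℕ × ℕ) (J := ℕ) (fun p => W p.1 p.2) (fun p => hW _ _)
    (fun n => {p | p.1 = n}) (fun n z => ?_) (fun α => x (g α)) fun S hS => ?_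
  · obtain ⟨k, hk⟩ := hcov n z
    exact ⟨(n, k), rfl, hk⟩
  · obtain ⟨β, hβ⟩ := hh fun n => (S n).sup Prod.snd
    refine ⟨univ, countable_univ, fun n => ⟨n, mem_univ _, hS n⟩, β, fun α hα => ?_⟩
    obtain ⟨n, hn⟩ := hg α β hα
    refine ⟨n, mem_univ _, fun p hp hxp => hx (g α) n ?_⟩
    have hpn : p.1 = n := hS n hp
    subst hpn
    refine hmono _ ?_ hxp
    rw [hβ] at hn
    exact (Finset.le_sup (f := Prod.snd) hp).trans hn

/-! ### Alster spaces are productively Lindelöf -/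

lemma AlsterSpace.lindelofSpace {X : Type u} [TopologicalSpace X] (hX : AlsterSpace X) :
    LindelofSpace X := by
  refine ⟨isLindelof_of_countable_subcover fun {κ} W hW hcov => ?_⟩
  obtain ⟨𝒢', h𝒢', hc, hun⟩ := hX (range fun t : Finset κ => ⋃ i ∈ t, W i) ⟨by
    rintro _ ⟨t, rfl⟩
    exact (isOpen_biUnion fun i _ => hW i).isGδ, fun K _ hK => by
    obtain ⟨t, ht⟩ := hK.elim_finite_subcover W hW ((subset_univ K).trans hcov)
    exact ⟨_, ⟨t, rfl⟩, ht⟩⟩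
  have : ∀ G ∈ 𝒢', ∃ t : Finset κ, ⋃ i ∈ t, W i = G := fun G hG => h𝒢' hG
  choose! t ht using this
  refine ⟨⋃ G ∈ 𝒢', (t G : Set κ), hc.biUnion fun G _ => (t G).countable_toSet, ?_⟩
  rw [← hun]
  rintro x ⟨G, hG, hx⟩
  rw [← ht G hG] at hx
  obtain ⟨i, hi, hxi⟩ := mem_iUnion₂.1 hx
  exact mem_biUnion (mem_biUnion hG hi) hxi

/-- For `Y` Lindelöf and an open covering of `X × Y`, the tube lemma provides for every compact
`K ⊆ X` a `G_δ` set `G ⊇ K` such that `G × Y` is covered by countably many members. -/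
lemma AlsterSpace.productivelyLindelof {X : Type u} [TopologicalSpace X] (hX : AlsterSpace X) :
    ProductivelyLindelof.{u, v} X := by
  refine ⟨hX.lindelofSpace, fun Y _ hY => ⟨isLindelof_of_countable_subcover ?_⟩⟩
  intro κ W hW hcov
  have htube : ∀ K : Set X, IsCompact K → ∀ y : Y, ∃ (A : Set X) (V : Set Y) (t : Finset κ),
      IsOpen A ∧ IsOpen V ∧ K ⊆ A ∧ y ∈ V ∧ A ×ˢ V ⊆ ⋃ i ∈ t, W i := by
    intro K hK y
    obtain ⟨t, ht⟩ := (hK.prod isCompact_singleton).elim_finite_subcover W hW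
      ((subset_univ (K ×ˢ {y})).trans hcov)
    obtain ⟨A, V, hA, hV, hKA, hyV, hAV⟩ := generalized_tube_lemma hK isCompact_singleton
      (isOpen_biUnion fun i _ => hW i) ht
    exact ⟨A, V, t, hA, hV, hKA, hyV rfl, hAV⟩
  obtain ⟨𝒢', h𝒢', hc, hun⟩ := hX
    {G | IsGδ G ∧ ∃ r : Set κ, r.Countable ∧ G ×ˢ univ ⊆ ⋃ i ∈ r, W i} ⟨fun G hG => hG.1, by
      intro K _ hK
      choose A V t hA hV hKA hyV hAV using htube K hK
      obtain ⟨s, hs, hsV⟩ := isLindelof_univ.elim_countable_subcover V hV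
        (fun y _ => mem_iUnion.2 ⟨y, hyV y⟩)
      refine ⟨⋂ y ∈ s, A y, ⟨IsGδ.biInter hs fun y _ => (hA y).isGδ,
        ⋃ y ∈ s, (t y : Set κ), hs.biUnion fun y _ => (t y).countable_toSet, ?_⟩,
        subset_iInter₂ fun y _ => hKA y⟩
      rintro ⟨x, z⟩ ⟨hx, -⟩
      obtain ⟨y, hy, hzy⟩ := mem_iUnion₂.1 (hsV (mem_univ z))
      obtain ⟨i, hi, hp⟩ := mem_iUnion₂.1 (hAV y ⟨mem_iInter₂.1 hx y hy, hzy⟩)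
      exact mem_biUnion (mem_biUnion hy hi) hp⟩
  have : ∀ G ∈ 𝒢', ∃ r : Set κ, r.Countable ∧ G ×ˢ univ ⊆ ⋃ i ∈ r, W i := fun G hG => (h𝒢' hG).2
  choose! r hr hrW using this
  refine ⟨⋃ G ∈ 𝒢', r G, hc.biUnion hr, ?_⟩
  rintro ⟨x, y⟩ -
  obtain ⟨G, hG, hx⟩ : x ∈ ⋃₀ 𝒢' := hun ▸ mem_univ x
  obtain ⟨i, hi, hp⟩ := mem_iUnion₂.1 (hrW G hG (mk_mem_prod hx (mem_univ y)))
  exact mem_biUnion (mem_biUnion hG hi) hp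

/-! ### Countable subfamilies of coverings of size `ℵ₁` -/

section Tree

variable {E : Type*}

/-- `M` is big with respect to the transfinite sequence `P` if it meets every term of `P`. -/
def IsBig (P : OmegaOne → Set E) (M : Set E) : Prop := ∀ β, (M ∩ P β).Nonempty

variable {P : OmegaOne → Set E}

lemma IsBig.inter_of_subset (hP : Antitone P) {M N : Set E} (hM : IsBig P M) {β : OmegaOne}
    (hN : P β ⊆ N) : IsBig P (M ∩ N) := by
  intro γ
  obtain ⟨t, htM, htP⟩ := hM (max β γ)
  exact ⟨t, ⟨htM, hN (hP (le_max_left _ _) htP)⟩, hP (le_max_right _ _) htP⟩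

/-- The sets that are not big form a `σ`-ideal, since countable subsets of `ω₁` are bounded. -/
lemma IsBig.exists_of_subset_iUnion (hP : Antitone P) {M : Set E} (hM : IsBig P M) {κ : Type*}
    [Countable κ] {N : κ → Set E} (h : M ⊆ ⋃ n, N n) : ∃ n, IsBig P (N n) := by
  by_contra! hN
  simp only [IsBig, not_forall] at hN
  choose β hβ using hN
  obtain ⟨γ, hγ⟩ := OmegaOne.exists_forall_lt (countable_range β)
  obtain ⟨t, htM, htP⟩ := hM γ
  obtain ⟨n, hn⟩ := mem_iUnion.1 (h htM)
  exact hβ n ⟨t, hn, hP (hγ _ ⟨n, rfl⟩).le htP⟩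

variable {X : Type*} [TopologicalSpace E]

/-- `B` is a family of closed sets, indexed by `ω₁`, which contains arbitrarily small
neighbourhoods of every point. -/
structure IsClosedNhdsFamily (B : OmegaOne → Set E) : Prop where
  isClosed : ∀ i, IsClosed (B i)
  exists_subset : ∀ O : Set E, IsOpen O → ∀ t ∈ O, ∃ i, t ∈ interior (B i) ∧ B i ⊆ O

/-- A big closed set has a big closed subset avoiding a given `G_δ` set that is disjoint from some
term of `P`: the complement of the `G_δ` set is a countable union of closed sets. -/
lemma IsBig.exists_isClosed_disjoint (hP : Antitone P) {M : Set E} (hM : IsBig P M)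
    (hMc : IsClosed M) {G : Set E} (hG : IsGδ G) {β : OmegaOne} (hGP : Disjoint G (P β)) :
    ∃ N ⊆ M, IsClosed N ∧ IsBig P N ∧ Disjoint N G := by
  obtain ⟨O, hO, rfl⟩ := isGδ_iff_eq_iInter_nat.1 hG
  have hM' := hM.inter_of_subset hP hGP.subset_compl_left
  obtain ⟨n, hn⟩ := hM'.exists_of_subset_iUnion hP (N := fun n => M ∩ (O n)ᶜ) (by
    rw [← inter_iUnion, compl_iInter])
  refine ⟨_, inter_subset_left, hMc.inter (hO n).isClosed_compl, hn, ?_⟩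
  rw [disjoint_left]
  exact fun t ht htO => ht.2 (mem_iInter.1 htO n)

lemma IsBig.exists_isClosed_disjoint_of_list (hP : Antitone P) {G : OmegaOne → Set E}
    (hG : ∀ ξ, IsGδ (G ξ)) (hGP : ∀ ξ, ∃ β, Disjoint (G ξ) (P β)) (l : List OmegaOne)
    {M : Set E} (hM : IsBig P M) (hMc : IsClosed M) :
    ∃ N ⊆ M, IsClosed N ∧ IsBig P N ∧ ∀ ξ ∈ l, Disjoint N (G ξ) := by
  induction l with
  | nil => exact ⟨M, subset_rfl, hMc, hM, by simp⟩
  | cons ξ l ih =>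
    obtain ⟨N, hNM, hNc, hN, hNl⟩ := ih
    obtain ⟨β, hβ⟩ := hGP ξ
    obtain ⟨N', hN', hNc', hNb', hd⟩ := hN.exists_isClosed_disjoint hP hNc (hG ξ) hβ
    refine ⟨N', hN'.trans hNM, hNc', hNb', fun ζ hζ => ?_⟩
    rcases List.mem_cons.1 hζ with rfl | h
    · exact hd
    · exact (hNl ζ h).mono_left hN'

lemma IsBig.inter_list (hP : Antitone P) {C : OmegaOne → Set E} (hC : ∀ β, IsClosed (C β))
    (hPC : ∀ β, P β ⊆ C β) (l : List OmegaOne) {M : Set E} (hM : IsBig P M) (hMc : IsClosed M) :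
    ∃ N ⊆ M, IsClosed N ∧ IsBig P N ∧ ∀ ξ ∈ l, N ⊆ C ξ := by
  induction l with
  | nil => exact ⟨M, subset_rfl, hMc, hM, by simp⟩
  | cons ξ l ih =>
    obtain ⟨N, hNM, hNc, hN, hNl⟩ := ih
    refine ⟨N ∩ C ξ, inter_subset_left.trans hNM, hNc.inter (hC ξ),
      hN.inter_of_subset hP (hPC ξ), fun ζ hζ => ?_⟩
    rcases List.mem_cons.1 hζ with rfl | h
    · exact inter_subset_right
    · exact inter_subset_left.trans (hNl ζ h)

/-- A big closed set has a point outside `X` at which it is locally big. Otherwise its points of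
local bigness form a compact subset of `X`, hence lie in one of the `G_δ` sets `G`; but
outside of `G` the set is a countable union of compact sets which are locally, hence globally, not
big. -/
lemma IsBig.exists_notMem_range [CompactSpace E] (hP : Antitone P) {e : X → E}
    {G : OmegaOne → Set E} (hG : ∀ ξ, IsGδ (G ξ)) (hGP : ∀ ξ, ∃ β, Disjoint (G ξ) (P β))
    (hK : ∀ K ⊆ range e, IsCompact K → ∃ ξ, K ⊆ G ξ) {M : Set E} (hM : IsBig P M)
    (hMc : IsClosed M) : ∃ b ∉ range e, ∀ N ∈ 𝓝 b, IsBig P (M ∩ N) := by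
  by_contra! hbad
  have hsub : {b | ∀ N ∈ 𝓝 b, IsBig P (M ∩ N)} ⊆ range e := by
    intro b hb
    by_contra hbe
    obtain ⟨N, hN, hNb⟩ := hbad b hbe
    exact hNb (hb N hN)
  have hclosed : IsClosed {b | ∀ N ∈ 𝓝 b, IsBig P (M ∩ N)} := by
    rw [← isOpen_compl_iff, isOpen_iff_mem_nhds]
    intro b hb
    simp only [mem_compl_iff, mem_ofPred_eq, not_forall] at hb
    obtain ⟨N, hN, hNb⟩ := hb
    filter_upwards [eventually_mem_nhds_iff.2 hN] with z hz hz'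
    exact hNb (hz' N hz)
  obtain ⟨ξ, hξ⟩ := hK _ hsub hclosed.isCompact
  obtain ⟨β, hβ⟩ := hGP ξ
  obtain ⟨N, hNM, hNc, hN, hd⟩ := hM.exists_isClosed_disjoint hP hMc (hG ξ) hβ
  have hloc : ∀ t ∈ N, ∃ V ∈ 𝓝 t, ¬ IsBig P (M ∩ V) := by
    intro t ht
    by_contra! h
    exact disjoint_left.1 hd ht (hξ h)
  choose! V hV hVb using hloc
  obtain ⟨s, hs, hcov⟩ := hNc.isCompact.elim_nhds_subcover V hV
  obtain ⟨⟨t, ht⟩, htb⟩ := hN.exists_of_subset_iUnion hP (κ := s) (N := fun t => M ∩ V t) (by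
    intro z hz
    obtain ⟨t, ht, hzt⟩ := mem_iUnion₂.1 (hcov hz)
    exact mem_iUnion.2 ⟨⟨t, ht⟩, hNM hz, hzt⟩)
  exact hVb t (hs t ht) htb

variable [TopologicalSpace X]

/-- A point `b` outside a Lindelöf subspace is separated from all its points by countably many
members of `B`, each of them containing a smaller neighbourhood from `B` in its interior. -/
lemma exists_separating_sequence [LindelofSpace X] [Nonempty X] [T1Space E] {e : X → E}
    (he : Continuous e)
    {B : OmegaOne → Set E} (hB : IsClosedNhdsFamily B) {b : E} (hb : b ∉ range e) :
    ∃ i : ℕ → OmegaOne, ∃ D : ℕ → Set E, (∀ k, IsClosed (D k) ∧ D k ∈ 𝓝 b ∧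
      D k ⊆ interior (B (i k))) ∧ ∀ x, ∃ k, e x ∉ B (i k) := by
  have hx : ∀ x, ∃ i, b ∈ interior (B i) ∧ e x ∉ B i := by
    intro x
    obtain ⟨i, hi, hsub⟩ := hB.exists_subset {e x}ᶜ isOpen_compl_singleton b
      (fun h => hb ⟨x, h.symm⟩)
    exact ⟨i, hi, fun h => hsub h rfl⟩
  choose i hbi hxi using hx
  obtain ⟨s, hs, hcov⟩ := LindelofSpace.elim_nhds_subcover (fun x => e ⁻¹' (B (i x))ᶜ)
    (fun x => ((hB.isClosed _).isOpen_compl.preimage he).mem_nhds (hxi x))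
  have hne : s.Nonempty := by
    obtain ⟨x⟩ := ‹Nonempty X›
    obtain ⟨z, hz, -⟩ := mem_iUnion₂.1 (hcov ▸ mem_univ x : x ∈ ⋃ x ∈ s, e ⁻¹' (B (i x))ᶜ)
    exact ⟨z, hz⟩
  obtain ⟨z, rfl⟩ := hs.exists_eq_range hne
  choose j hbj hj using fun k => hB.exists_subset _ isOpen_interior b (hbi (z k))
  refine ⟨fun k => i (z k), fun k => B (j k), fun k => ⟨hB.isClosed _,
    mem_interior_iff_mem_nhds.1 (hbj k), hj k⟩, fun x => ?_⟩
  obtain ⟨_, ⟨k, rfl⟩, hk⟩ :=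
    mem_iUnion₂.1 (hcov ▸ mem_univ x : x ∈ ⋃ x ∈ range z, e ⁻¹' (B (i x))ᶜ)
  exact ⟨k, hk⟩

/-- One round of the tree construction below, at the node carrying the big closed set `M`. The
indices `i k` describe the covering played at this node, `a` is a bound for them, and `N k` is the
big closed set carried by the `k`-th successor. Each `N k` is contained in `C b` for the bounds `b`
in `hist`, and avoids the `G ξ` with `ξ` in `l`. -/
lemma IsBig.exists_extension [CompactSpace E] [T1Space E] [LindelofSpace X] [Nonempty X]
    (hP : Antitone P) {e : X → E} (he : Continuous e)
    {B : OmegaOne → Set E} (hB : IsClosedNhdsFamily B)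
    {G : OmegaOne → Set E} (hG : ∀ ξ, IsGδ (G ξ)) (hGP : ∀ ξ, ∃ β, Disjoint (G ξ) (P β))
    (hK : ∀ K ⊆ range e, IsCompact K → ∃ ξ, K ⊆ G ξ)
    {C : OmegaOne → Set E} (hC : ∀ β, IsClosed (C β)) (hPC : ∀ β, P β ⊆ C β)
    {M : Set E} (hM : IsBig P M) (hMc : IsClosed M) (hist l : List OmegaOne) :
    ∃ (a : OmegaOne) (i : ℕ → OmegaOne) (N : ℕ → Set E), (∀ k, i k < a) ∧
      (∀ x, ∃ k, e x ∉ B (i k)) ∧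
      ∀ k, IsClosed (N k) ∧ IsBig P (N k) ∧ N k ⊆ M ∧ (∀ j ≤ k, N k ⊆ interior (B (i j))) ∧
        (∀ b ∈ hist, N k ⊆ C b) ∧ ∀ ξ ∈ l, Disjoint (N k) (G ξ) := by
  obtain ⟨b, hb, hbig⟩ := hM.exists_notMem_range hP hG hGP hK hMc
  obtain ⟨i, D, hD, hi⟩ := exists_separating_sequence he hB hb
  obtain ⟨a, ha⟩ := OmegaOne.exists_forall_lt (countable_range i)
  have : ∀ k, ∃ N, IsClosed N ∧ IsBig P N ∧ N ⊆ M ∧ (∀ j ≤ k, N ⊆ interior (B (i j))) ∧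
      (∀ b ∈ hist, N ⊆ C b) ∧ ∀ ξ ∈ l, Disjoint N (G ξ) := by
    intro k
    have h0 : IsBig P (M ∩ ⋂ j ∈ Iic k, D j) :=
      hbig _ ((Filter.biInter_mem (finite_Iic k)).2 fun j _ => (hD j).2.1)
    have h0c : IsClosed (M ∩ ⋂ j ∈ Iic k, D j) :=
      hMc.inter (isClosed_biInter fun j _ => (hD j).1)
    obtain ⟨N₁, h₁, h₁c, h₁b, h₁C⟩ := h0.inter_list hP hC hPC hist h0c
    obtain ⟨N, h₂, h₂c, h₂b, h₂G⟩ := h₁b.exists_isClosed_disjoint_of_list hP hG hGP l h₁c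
    refine ⟨N, h₂c, h₂b, (h₂.trans h₁).trans inter_subset_left, fun j hj => ?_,
      fun b hb => h₂.trans (h₁C b hb), h₂G⟩
    exact ((h₂.trans h₁).trans inter_subset_right).trans
      ((biInter_subset_of_mem (mem_Iic.2 hj)).trans (hD j).2.2)
  choose N hN using this
  exact ⟨a, i, N, fun k => ha _ ⟨k, rfl⟩, hi, hN⟩

/-- The heart of the argument. Let `C` be a decreasing sequence of closed sets, continuous in the
sense that the supremum of a sequence of indices yields the intersection, such that every point of
`C β` outside of the earlier `G ξ` shares its neighbourhoods `B i`, `i < β`, with a point of `X`.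
Then some `C β` is covered by the earlier `G ξ`. If not, grow a tree of big closed sets, along each
branch of which a point of `X` gets trapped: the separating sequences at the nodes then form a
strategy in the Menger game that is never defeated. -/
lemma MengerSpace.exists_subset_iUnion_lt [CompactSpace E] [T1Space E] [LindelofSpace X]
    [Nonempty X] (hX : MengerSpace X) {e : X → E} (he : Continuous e)
    {B : OmegaOne → Set E} (hB : IsClosedNhdsFamily B)
    {G : OmegaOne → Set E} (hG : ∀ ξ, IsGδ (G ξ))
    (hK : ∀ K ⊆ range e, IsCompact K → ∃ ξ, K ⊆ G ξ)
    {C : OmegaOne → Set E} (hC : ∀ β, IsClosed (C β)) (hCanti : Antitone C)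
    (hCsup : ∀ (a : ℕ → OmegaOne) (β : OmegaOne), (∀ n, a n ≤ β) → (∀ c < β, ∃ n, c < a n) →
      ⋂ n, C (a n) ⊆ C β)
    (hCX : ∀ β, ∀ t ∈ C β, (∀ ξ < β, t ∉ G ξ) → ∃ x, ∀ i < β, t ∈ interior (B i) → e x ∈ B i) :
    ∃ β, C β ⊆ ⋃ ξ ∈ Iio β, G ξ := by
  classical
  by_contra! hne
  let P : OmegaOne → Set E := fun β => C β \ ⋃ ξ ∈ Iio β, G ξ
  have hP : Antitone P := fun β γ h => sdiff_subset_sdiff (hCanti h)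
    (biUnion_mono (Iio_subset_Iio h) fun _ _ => subset_rfl)
  have hPC : ∀ β, P β ⊆ C β := fun β => sdiff_subset
  have hGP : ∀ ξ, ∃ β, Disjoint (G ξ) (P β) := by
    intro ξ
    obtain ⟨β, hβ⟩ := OmegaOne.exists_forall_lt (countable_singleton ξ)
    refine ⟨β, disjoint_left.2 fun t ht htP => htP.2 ?_⟩
    exact mem_biUnion (mem_Iio.2 (hβ ξ rfl)) ht
  have huniv : IsBig P univ := fun β => by
    rw [univ_inter]
    exact sdiff_nonempty.2 (hne β)
  -- Enumerate the predecessors of each index, with repetitions and possibly other indices.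
  have henum : ∀ b : OmegaOne, ∃ f : ℕ → OmegaOne, Iio b ⊆ range f := by
    intro b
    rcases (Iio b).eq_empty_or_nonempty with h | h
    · exact ⟨fun _ => b, by simp [h]⟩
    · obtain ⟨f, hf⟩ := (OmegaOne.countable_Iio b).exists_eq_range h
      exact ⟨f, hf.subset⟩
  choose enum henum using henum
  -- After each round, the `G ξ` with `ξ` among the first enumerated predecessors of each bound met
  -- so far are avoided, so that on a branch all of them are avoided eventually.
  let toAvoid : List OmegaOne → List OmegaOne := fun hist =>
    hist.flatMap fun b => (List.range hist.length).map (enum b)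
  let State := {M : Set E // IsClosed M ∧ IsBig P M} × List OmegaOne
  choose a i N ha hi hN using fun σ : State =>
    σ.1.2.2.exists_extension hP he hB hG hGP hK hC hPC σ.1.2.1 σ.2 (toAvoid σ.2)
  let next : State → ℕ → State := fun σ k => (⟨N σ k, (hN σ k).1, (hN σ k).2.1⟩, a σ :: σ.2)
  let node : List ℕ → State := fun s =>
    s.foldr (fun k σ => next σ k) (⟨univ, isClosed_univ, huniv⟩, [])
  obtain ⟨f, hf⟩ := hX.exists_play (fun s k => ⋃ j ∈ Iic k, e ⁻¹' (B (i (node s) j))ᶜ)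
    (fun s k => isOpen_biUnion fun j _ => (hB.isClosed _).isOpen_compl.preimage he)
    (fun s k l hkl => biUnion_mono (Iic_subset_Iic.2 hkl) fun _ _ => subset_rfl)
    (fun s x => (hi (node s) x).imp fun k hk => mem_biUnion self_mem_Iic hk)
  let σ : ℕ → State := fun n => node (initialSegment f n)
  have hσ : ∀ n, σ (n + 1) = next (σ n) (f n) := fun n => rfl
  have hσ1 : ∀ n, ((σ (n + 1)).1 : Set E) = N (σ n) (f n) := fun n => rfl
  have hσ2 : ∀ n, (σ (n + 1)).2 = a (σ n) :: (σ n).2 := fun n => rfl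
  have hlen : ∀ n, (σ n).2.length = n := by
    intro n
    induction n with
    | zero => rfl
    | succ n ih => rw [hσ2, List.length_cons, ih]
  have hmem : ∀ n m, n < m → a (σ n) ∈ (σ m).2 := by
    intro n m hnm
    induction m, hnm using Nat.le_induction with
    | base => rw [hσ2]; exact List.mem_cons_self
    | succ m _ ih => rw [hσ2]; exact List.mem_cons_of_mem _ ih
  obtain ⟨t, ht⟩ : (⋂ n, ((σ n).1 : Set E)).Nonempty := by
    refine IsCompact.nonempty_iInter_of_sequence_nonempty_isCompact_isClosed _
      (fun n => by rw [hσ1]; exact (hN _ _).2.2.1) (fun n => ?_) (σ 0).1.2.1.isCompact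
      (fun n => (σ n).1.2.1)
    exact ((σ n).1.2.2 (Classical.arbitrary _)).mono inter_subset_left
  have ht : ∀ n, t ∈ N (σ n) (f n) := fun n => by
    rw [← hσ1]; exact mem_iInter.1 ht (n + 1)
  obtain ⟨β, hβ, hβ'⟩ := OmegaOne.exists_sup fun n => a (σ n)
  have htC : t ∈ C β := by
    refine hCsup _ β hβ hβ' (mem_iInter.2 fun n => ?_)
    exact (hN (σ (n + 1)) (f (n + 1))).2.2.2.2.1 _ (hmem n (n + 1) n.lt_succ_self) (ht (n + 1))
  have htG : ∀ ξ < β, t ∉ G ξ := by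
    intro ξ hξ
    obtain ⟨n, hn⟩ := hβ' ξ hξ
    obtain ⟨m, rfl⟩ := henum _ hn
    let r := max n m + 1
    refine disjoint_left.1 ((hN (σ r) (f r)).2.2.2.2.2 _ ?_) (ht r)
    refine List.mem_flatMap.2 ⟨a (σ n), hmem n r (by omega), List.mem_map.2 ⟨m, ?_, rfl⟩⟩
    rw [List.mem_range, hlen]
    omega
  obtain ⟨x, hx⟩ := hCX β t htC htG
  obtain ⟨n, hn⟩ := hf x
  obtain ⟨j, hj, hjx⟩ := mem_iUnion₂.1 hn
  exact hjx (hx _ ((ha (σ n) j).trans_le (hβ n)) ((hN (σ n) (f n)).2.2.2.1 j hj (ht n)))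

end Tree

/-- Countable subcoverings of Alster coverings of size `ℵ₁`. If there were none, choose points
`x α` avoiding the first `α` members of the covering. For `t` outside of the first `α` members, the
neighbourhoods `B i` of `t` with `i < α` name a covering of `X` as soon as they separate `t` from
the points of `X`. By the previous lemma, these coverings and the points `x α` satisfy the
assumptions of the Michael-type construction. -/
lemma ProductivelyLindelof.exists_countable_subcover {X : Type u} [TopologicalSpace X]
    (hX : ProductivelyLindelof.{u, v} X) (hXM : MengerSpace X) {E : Type} [TopologicalSpace E]
    [CompactSpace E] [T1Space E] {e : X → E} (he : Continuous e)
    {B : OmegaOne → Set E} (hB : IsClosedNhdsFamily B)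
    {G : OmegaOne → Set E} (hG : ∀ ξ, IsGδ (G ξ))
    (hK : ∀ K ⊆ range e, IsCompact K → ∃ ξ, K ⊆ G ξ) :
    ∃ s : Set OmegaOne, s.Countable ∧ range e ⊆ ⋃ ξ ∈ s, G ξ := by
  classical
  by_contra! hbad
  have := hX.1
  have hx : ∀ α : OmegaOne, ∃ x, ∀ ξ < α, e x ∉ G ξ := by
    intro α
    obtain ⟨_, ⟨x, rfl⟩, hx⟩ := not_subset.1 (hbad _ (OmegaOne.countable_Iio α))
    exact ⟨x, fun ξ hξ h => hx (mem_biUnion (mem_Iio.2 hξ) h)⟩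
  choose x hx using hx
  have : Nonempty X := ⟨x (Classical.arbitrary _)⟩
  let J := {p : OmegaOne × E // (∀ ξ < p.1, p.2 ∉ G ξ) ∧
    ∀ z, ∃ i < p.1, p.2 ∈ interior (B i) ∧ e z ∉ B i}
  refine hX.false_of_concentrated (J := J) (fun i => e ⁻¹' (B i)ᶜ)
    (fun i => (hB.isClosed i).isOpen_compl.preimage he)
    (fun j => {i | i < j.1.1 ∧ j.1.2 ∈ interior (B i)}) (fun j z => ?_) x fun S hS => ?_
  · obtain ⟨i, hi, hi', hz⟩ := j.2.2 z
    exact ⟨i, ⟨hi, hi'⟩, hz⟩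
  let C : OmegaOne → Set E := fun β =>
    {t | ∀ j : J, (∀ i ∈ S j, i < β) → ∃ i ∈ S j, t ∉ interior (B i)}
  obtain ⟨β, hβ⟩ := hXM.exists_subset_iUnion_lt he hB hG hK (C := C) (fun β => by
      have : C β = ⋂ j : J, ⋂ _ : ∀ i ∈ S j, i < β, ⋃ i ∈ S j, (interior (B i))ᶜ := by
        ext t; simp [C]
      rw [this]
      exact isClosed_iInter fun j => isClosed_iInter fun _ =>
        (S j).finite_toSet.isClosed_biUnion fun i _ => isOpen_interior.isClosed_compl)
    (fun β γ h t ht j hj => ht j fun i hi => (hj i hi).trans_le h)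
    (by
      intro a β haβ hβ t ht j hj
      -- A finite set of indices below the supremum lies below some term of the sequence.
      have : ∃ n, ∀ i ∈ S j, i < a n := by
        by_cases hne : (S j).Nonempty
        · obtain ⟨n, hn⟩ := hβ _ (hj _ ((S j).max'_mem hne))
          exact ⟨n, fun i hi => ((S j).le_max' i hi).trans_lt hn⟩
        · exact ⟨0, fun i hi => absurd ⟨i, hi⟩ hne⟩
      obtain ⟨n, hn⟩ := this
      exact mem_iInter.1 ht n j hn)
    (by
      intro β t ht htG
      by_contra! h
      let j : J := ⟨(β, t), htG, h⟩
      obtain ⟨i, hi, hti⟩ := ht j fun i hi => (hS j hi).1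
      exact hti (hS j hi).2)
  -- Only countably many finite sets of indices lie below `β`, so that countably many of the
  -- coverings realize all the choices contained in them.
  have hcount : {s : Finset OmegaOne | ∀ i ∈ s, i < β}.Countable := by
    refine ((countable_ofPred_finite_subset (OmegaOne.countable_Iio β)).preimage
      Finset.coe_injective).mono fun s hs => ?_
    exact ⟨s.finite_toSet, hs⟩
  have hreal : ∃ J₀ : Set J, J₀.Countable ∧ ∀ j, (∀ i ∈ S j, i < β) → ∃ j₀ ∈ J₀, S j₀ = S j := by
    have hc : (S '' {j | ∀ i ∈ S j, i < β}).Countable :=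
      hcount.mono (by rintro _ ⟨j, hj, rfl⟩; exact hj)
    obtain ⟨J₀, -, hJ₀⟩ := exists_subset_bijOn {j | ∀ i ∈ S j, i < β} S
    refine ⟨J₀, countable_of_injective_of_countable_image hJ₀.injOn (hJ₀.image_eq ▸ hc),
      fun j hj => ?_⟩
    obtain ⟨j₀, hj₀, h⟩ := hJ₀.surjOn (mem_image_of_mem S hj)
    exact ⟨j₀, hj₀, h⟩
  obtain ⟨J₀, hJ₀, hreal⟩ := hreal
  have houtside : ∀ t, (∀ ξ < β, t ∉ G ξ) →
      ∃ j ∈ J₀, (∀ i ∈ S j, i < β) ∧ ∀ i ∈ S j, t ∈ interior (B i) := by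
    intro t ht
    have htC : t ∉ C β := fun h => by
      obtain ⟨ξ, hξ, h⟩ := mem_iUnion₂.1 (hβ h)
      exact ht ξ hξ h
    simp only [C, mem_ofPred_eq, not_forall, not_exists, not_and, not_not] at htC
    obtain ⟨j, hj, hjt⟩ := htC
    obtain ⟨j₀, hj₀, h⟩ := hreal j hj
    exact ⟨j₀, hj₀, h ▸ hj, h ▸ hjt⟩
  refine ⟨J₀, hJ₀, fun j' => ?_, β, fun α hα => ?_⟩
  · rcases le_or_gt j'.1.1 β with h | h
    · obtain ⟨j₀, hj₀, h'⟩ := hreal j' fun i hi => (hS j' hi).1.trans_le h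
      exact ⟨j₀, hj₀, h' ▸ hS j'⟩
    · obtain ⟨j, hj, hjβ, hjt⟩ := houtside j'.1.2 fun ξ hξ => j'.2.1 ξ (hξ.trans h)
      exact ⟨j, hj, fun i hi => ⟨(hjβ i hi).trans h, hjt i hi⟩⟩
  · obtain ⟨j, hj, -, hjt⟩ := houtside (e (x α)) fun ξ hξ => hx α ξ (hξ.trans hα)
    exact ⟨j, hj, fun i hi => not_not.2 (interior_subset (hjt i hi))⟩

/-! ### Spaces of weight at most `ℵ₁` -/

lemma TychonoffCube.continuous_coe_apply (i : OmegaOne) :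
    Continuous fun t : TychonoffCube => (t i : ℝ) :=
  continuous_subtype_val.comp (continuous_apply i)

lemma TychonoffCube.exists_isClosedNhdsFamily :
    ∃ B : OmegaOne → Set TychonoffCube, IsClosedNhdsFamily B := by
  classical
  have : Infinite OmegaOne := by
    rw [Cardinal.infinite_iff, mk_omegaOne]
    exact Cardinal.aleph0_lt_aleph_one.le
  obtain ⟨p, hp⟩ := exists_range_eq_of_mk_le (P := Finset (OmegaOne × ℚ × ℚ)) (by
    rw [Cardinal.mk_finset_of_infinite, Cardinal.mk_prod, Cardinal.mk_prod, mk_omegaOne]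
    simp [Cardinal.mul_aleph0_eq Cardinal.aleph0_lt_aleph_one.le])
  let box : Finset (OmegaOne × ℚ × ℚ) → Set TychonoffCube := fun s =>
    ⋂ c ∈ s, {t | (t c.1 : ℝ) ∈ Icc (c.2.1 : ℝ) c.2.2}
  refine ⟨fun i => box (p i), fun i => isClosed_biInter fun c _ =>
    isClosed_Icc.preimage (TychonoffCube.continuous_coe_apply c.1), fun O hO t ht => ?_⟩
  obtain ⟨I, V, hV, hsub⟩ := isOpen_pi_iff.1 hO t ht
  have hab : ∀ i, ∃ ab : ℚ × ℚ, (t i : ℝ) ∈ Ioo (ab.1 : ℝ) ab.2 ∧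
      (i ∈ I → ∀ z : unitInterval, (z : ℝ) ∈ Icc (ab.1 : ℝ) ab.2 → z ∈ V i) := by
    intro i
    by_cases hi : i ∈ I
    · obtain ⟨ε, hε, hball⟩ := Metric.isOpen_iff.1 (hV i hi).1 (t i) (hV i hi).2
      obtain ⟨a, ha, ha'⟩ := exists_rat_btwn (sub_lt_self (t i : ℝ) hε)
      obtain ⟨b, hb, hb'⟩ := exists_rat_btwn (lt_add_of_pos_right (t i : ℝ) hε)
      refine ⟨(a, b), ⟨ha', hb⟩, fun _ z hz => hball ?_⟩
      rw [Metric.mem_ball, Subtype.dist_eq, Real.dist_eq, abs_lt]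
      exact ⟨by linarith [hz.1], by linarith [hz.2]⟩
    · obtain ⟨a, ha⟩ := exists_rat_lt (t i : ℝ)
      obtain ⟨b, hb⟩ := exists_rat_gt (t i : ℝ)
      exact ⟨(a, b), ⟨ha, hb⟩, fun h => absurd h hi⟩
  choose ab hab habV using hab
  obtain ⟨i, hi⟩ := hp (I.image fun j => (j, ab j))
  refine ⟨i, ?_, fun z hz => hsub fun j hj => habV j hj _ ?_⟩
  · refine mem_interior.2 ⟨⋂ j ∈ I, {z | (z j : ℝ) ∈ Ioo ((ab j).1 : ℝ) (ab j).2}, ?_,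
      isOpen_biInter_finset fun j _ => isOpen_Ioo.preimage (TychonoffCube.continuous_coe_apply j),
      mem_iInter₂.2 fun j _ => hab j⟩
    intro z hz
    simp only [box, hi, mem_iInter]
    intro c hc
    obtain ⟨j, hj, rfl⟩ := Finset.mem_image.1 hc
    exact Ioo_subset_Icc_self (mem_iInter₂.1 hz j hj)
  · simp only [box, hi, mem_iInter] at hz
    exact hz _ (Finset.mem_image_of_mem _ hj)

lemma exists_basis_indexed_by_omegaOne {X : Type u} [TopologicalSpace X]
    (hw : topologicalWeight X ≤ Cardinal.aleph 1) :
    ∃ b : OmegaOne → Set X, ∀ O, IsOpen O → ∀ x ∈ O, ∃ i, IsOpen (b i) ∧ x ∈ b i ∧ b i ⊆ O := by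
  obtain ⟨𝒜, h𝒜, hcard⟩ : topologicalWeight X ∈ {κ : Cardinal.{u} | ∃ 𝒜 : Set (Set X),
      TopologicalSpace.IsTopologicalBasis 𝒜 ∧ #𝒜 = κ} :=
    csInf_mem ⟨_, _, TopologicalSpace.isTopologicalBasis_opens, rfl⟩
  rcases 𝒜.eq_empty_or_nonempty with rfl | hne
  · refine ⟨fun _ => ∅, fun O hO x hx => ?_⟩
    obtain ⟨A, hA, -⟩ := h𝒜.isOpen_iff.1 hO x hx
    exact absurd hA (notMem_empty A)
  · have := hne.to_subtype
    obtain ⟨b, hb⟩ := exists_range_eq_of_mk_le (hcard.trans_le hw)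
    refine ⟨fun i => b i, fun O hO x hx => ?_⟩
    obtain ⟨A, hA, hxA, hAO⟩ := h𝒜.isOpen_iff.1 hO x hx
    obtain ⟨i, hi⟩ := hb ⟨A, hA⟩
    obtain rfl : (b i : Set X) = A := congrArg Subtype.val hi
    exact ⟨i, h𝒜.isOpen hA, hxA, hAO⟩

/-- The Tychonoff embedding: for every pair of basic sets, use one coordinate for a continuous
function which is at most `1/2` on the first set and `1` off the second one, if there is any. -/
lemma exists_isInducing_tychonoffCube {X : Type u} [TopologicalSpace X] [CompletelyRegularSpace X]
    (hw : topologicalWeight X ≤ Cardinal.aleph 1) :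
    ∃ e : X → TychonoffCube, IsInducing e := by
  obtain ⟨b, hb⟩ := exists_basis_indexed_by_omegaOne hw
  obtain ⟨g, hg⟩ := exists_range_eq_of_mk_le (P := OmegaOne × OmegaOne) (by
    rw [Cardinal.mk_prod, mk_omegaOne]
    simp [Cardinal.mul_eq_self Cardinal.aleph0_lt_aleph_one.le])
  let Sep : OmegaOne × OmegaOne → (X → unitInterval) → Prop := fun p f =>
    Continuous f ∧ (∀ x ∈ b p.1, (f x : ℝ) ≤ 1 / 2) ∧ ∀ x ∉ b p.2, f x = 1
  have hφ : ∀ p, ∃ f : X → unitInterval, Continuous f ∧ ((∃ f, Sep p f) → Sep p f) := by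
    intro p
    by_cases h : ∃ f, Sep p f
    · obtain ⟨f, hf⟩ := h
      exact ⟨f, hf.1, fun _ => hf⟩
    · exact ⟨fun _ => 0, continuous_const, fun h' => absurd h' h⟩
  choose φ hφc hφ using hφ
  have hec : Continuous fun (x : X) (i : OmegaOne) => φ (g i) x :=
    continuous_pi fun i => hφc (g i)
  refine ⟨_, isInducing_iff_nhds.2 fun x => le_antisymm (hec.tendsto x).le_comap fun O hO => ?_⟩
  obtain ⟨j, hjo, hxj, hjO⟩ := hb _ isOpen_interior x (mem_interior_iff_mem_nhds.2 hO)
  obtain ⟨f, hf, hfx, hf1⟩ := CompletelyRegularSpace.completely_regular x (b j)ᶜ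
    hjo.isClosed_compl (not_not.2 hxj)
  have hopen : IsOpen {z | (f z : ℝ) < 1 / 2} :=
    isOpen_Iio.preimage (continuous_subtype_val.comp hf)
  obtain ⟨i, -, hxi, hi⟩ := hb _ hopen x (by simp [hfx])
  obtain ⟨k, hk⟩ := hg (i, j)
  obtain ⟨-, h1, h2⟩ := hφ (i, j) ⟨f, hf, fun z hz => (hi hz).le, hf1⟩
  refine Filter.mem_comap.2 ⟨{t | (t k : ℝ) < 1}, IsOpen.mem_nhds
    (isOpen_Iio.preimage (TychonoffCube.continuous_coe_apply k)) ?_, fun z hz => ?_⟩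
  · show (φ (g k) x : ℝ) < 1
    rw [hk]
    linarith [h1 x hxi]
  · by_contra hzO
    have hz : (φ (g k) z : ℝ) < 1 := hz
    rw [hk, h2 z fun h => hzO (interior_subset (hjO h))] at hz
    simp at hz

/-- Under the continuum hypothesis, there are only `ℵ₁` many sets of the form `⋂ n, V n`, where each
`V n` is a finite union of basic open sets, and between a compact set and a `G_δ` set containing it
there always is a set of this form. -/
lemma IsAlsterCovering.exists_refinement {X : Type u} [TopologicalSpace X]
    (hCH : ContinuumHypothesis) {E : Type*} [TopologicalSpace E] {e : X → E} (he : IsInducing e)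
    {B : OmegaOne → Set E} (hB : IsClosedNhdsFamily B) {𝒢 : Set (Set X)}
    (h𝒢 : IsAlsterCovering univ 𝒢) :
    ∃ G : OmegaOne → Set E, (∀ ξ, IsGδ (G ξ)) ∧
      (∀ K ⊆ range e, IsCompact K → ∃ ξ, K ⊆ G ξ) ∧ ∀ ξ, ∃ A ∈ 𝒢, e ⁻¹' G ξ ⊆ A := by
  let H : (ℕ → Finset OmegaOne) → Set E := fun σ => ⋂ n, ⋃ i ∈ σ n, interior (B i)
  let P := {σ : ℕ → Finset OmegaOne // ∃ A ∈ 𝒢, e ⁻¹' H σ ⊆ A}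
  have hP : ∀ K ⊆ range e, IsCompact K → ∃ σ : P, K ⊆ H σ := by
    intro K hKe hK
    obtain ⟨A, hA, hKA⟩ := h𝒢.2 _ (subset_univ _) (he.isCompact_preimage' hK hKe)
    obtain ⟨O, hO, rfl⟩ := isGδ_iff_eq_iInter_nat.1 (h𝒢.1 A hA)
    choose O' hO' hOO' using fun n => he.isOpen_iff.1 (hO n)
    have hσ : ∀ n, ∃ s : Finset OmegaOne, K ⊆ ⋃ i ∈ s, interior (B i) ∧
        ⋃ i ∈ s, interior (B i) ⊆ O' n := by
      intro n
      have hKO : ∀ t ∈ K, t ∈ O' n := by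
        intro t ht
        obtain ⟨x, rfl⟩ := hKe ht
        have : x ∈ e ⁻¹' O' n := hOO' n ▸ mem_iInter.1 (hKA ht) n
        exact this
      obtain ⟨s, hs, hsf, hcov⟩ := hK.elim_finite_subcover_image (b := {i | B i ⊆ O' n})
        (c := fun i => interior (B i)) (fun i _ => isOpen_interior) (fun t ht => by
          obtain ⟨i, hi, hsub⟩ := hB.exists_subset _ (hO' n) t (hKO t ht)
          exact mem_biUnion hsub hi)
      refine ⟨hsf.toFinset, by simpa using hcov, ?_⟩
      simp only [Set.Finite.mem_toFinset]
      exact iUnion₂_subset fun i hi => interior_subset.trans (hs hi)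
    choose σ hKσ hσO using hσ
    refine ⟨⟨σ, _, hA, fun x hx => mem_iInter.2 fun n => ?_⟩, subset_iInter hKσ⟩
    rw [← hOO' n]
    exact hσO n (mem_iInter.1 hx n)
  have : Nonempty P := (hP ∅ (empty_subset _) isCompact_empty).nonempty
  obtain ⟨f, hf⟩ := exists_range_eq_of_mk_le (P := P) (by
    refine (Cardinal.mk_subtype_le _).trans ?_
    have : Infinite OmegaOne := by
      rw [Cardinal.infinite_iff, mk_omegaOne]
      exact Cardinal.aleph0_lt_aleph_one.le
    rw [ContinuumHypothesis] at hCH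
    simp [Cardinal.mk_finset_of_infinite, hCH])
  refine ⟨fun ξ => H (f ξ), fun ξ => IsGδ.iInter_of_isOpen fun n =>
    isOpen_biUnion fun i _ => isOpen_interior, fun K hKe hK => ?_, fun ξ => (f ξ).2⟩
  obtain ⟨σ, hσ⟩ := hP K hKe hK
  obtain ⟨ξ, rfl⟩ := hf σ
  exact ⟨ξ, hσ⟩

lemma ProductivelyLindelof.alsterSpace {X : Type u} [TopologicalSpace X] [CompletelyRegularSpace X]
    (hCH : ContinuumHypothesis) (hw : topologicalWeight X ≤ Cardinal.aleph 1)
    (hX : ProductivelyLindelof.{u, v} X) : AlsterSpace X := by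
  intro 𝒢 h𝒢
  obtain ⟨e, he⟩ := exists_isInducing_tychonoffCube hw
  obtain ⟨B, hB⟩ := TychonoffCube.exists_isClosedNhdsFamily
  obtain ⟨G, hG, hK, hG𝒢⟩ := h𝒢.exists_refinement hCH he hB
  obtain ⟨s, hs, hcov⟩ := hX.exists_countable_subcover (hX.mengerSpace hCH) he.continuous hB hG hK
  choose A hA hGA using hG𝒢
  refine ⟨A '' s, by rintro _ ⟨ξ, -, rfl⟩; exact hA ξ, hs.image A, ?_⟩
  rw [eq_univ_iff_forall]
  intro x
  obtain ⟨ξ, hξ, hx⟩ := mem_iUnion₂.1 (hcov (mem_range_self x))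
  exact ⟨_, mem_image_of_mem A hξ, hGA ξ hx⟩

theorem theorem3p3 :
    (∀ (X : Set TychonoffCube) (𝒢 : Set (Set TychonoffCube)),
      ProductivelyLindelof.{0, 0} X →
      MengerSpace X →
      IsAlsterCovering X 𝒢 →
      (∀ G ∈ 𝒢, IsLindelof G) →
      #𝒢 = Cardinal.aleph 1 →
      ∃ 𝒢' ⊆ 𝒢, #𝒢' = Cardinal.aleph0 ∧ X ⊆ ⋃₀ 𝒢') ∧
    (ContinuumHypothesis →
      ∀ (X : Type u) [TopologicalSpace X] [T35Space X],
        topologicalWeight X ≤ Cardinal.aleph 1 →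
        (ProductivelyLindelof.{u, v} X ↔ AlsterSpace X)) := by
  refine ⟨fun X 𝒢 hX hXM h𝒢 _ hcard => ?_,
    fun hCH X _ _ hw => ⟨fun hX => hX.alsterSpace hCH hw, fun hX => hX.productivelyLindelof⟩⟩
  have hinf : 𝒢.Infinite := by
    rw [← infinite_coe_iff, Cardinal.infinite_iff, hcard]
    exact Cardinal.aleph0_lt_aleph_one.le
  have := hinf.nonempty.to_subtype
  obtain ⟨G, hG⟩ := exists_range_eq_of_mk_le hcard.le
  obtain ⟨B, hB⟩ := TychonoffCube.exists_isClosedNhdsFamily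
  obtain ⟨s, hs, hcov⟩ := hX.exists_countable_subcover hXM continuous_subtype_val hB
    (G := fun ξ => G ξ) (fun ξ => h𝒢.1 _ (G ξ).2) (fun K hKX hK => by
      rw [Subtype.range_coe] at hKX
      obtain ⟨A, hA, hKA⟩ := h𝒢.2 K hKX hK
      obtain ⟨ξ, hξ⟩ := hG ⟨A, hA⟩
      exact ⟨ξ, by rwa [hξ]⟩)
  -- Adding a countably infinite subfamily makes the subcovering infinite.
  obtain ⟨𝒜, h𝒜, h𝒜c, h𝒜inf⟩ := hinf.exists_subset_countable_infinite
  refine ⟨(fun ξ => (G ξ : Set TychonoffCube)) '' s ∪ 𝒜, union_subset ?_ h𝒜, ?_, ?_⟩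
  · rintro _ ⟨ξ, -, rfl⟩
    exact (G ξ).2
  · have hc := ((hs.image fun ξ => (G ξ : Set TychonoffCube)).union h𝒜c).to_subtype
    have hi := (h𝒜inf.mono (subset_union_right
      (s := (fun ξ => (G ξ : Set TychonoffCube)) '' s))).to_subtype
    exact Cardinal.mk_eq_aleph0 _
  · intro x hx
    obtain ⟨ξ, hξ, h⟩ := mem_iUnion₂.1 (hcov ⟨⟨x, hx⟩, rfl⟩)
    exact ⟨_, Or.inl (mem_image_of_mem _ hξ), h⟩
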